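/- A \emph{parking function of size $n$} is represented as a labeled Dyck path: a lattice path from $(0,0)$ to $(n,n)$ with $n$ unit north steps and $n$ unit east steps that never goes below the line $y=x$, whose north steps are labeled bijectively by $1,\dots,n$ so that the labels increase along consecutive north steps (the labels on the line $x=i$ are the cars that prefer spot $i+1$). Reading the labels of the north steps of $p$ in order gives a permutation $\phi(p)$ of $\{1,\dots,n\}$. A permutation $\pi$ avoids a pattern $\rho$ of length $m$ if there are no positions $i_1<\dots<i_m$ such that, for all $a,b$, $\pi_{i_a}\le\pi_{i_b}$ if and only if $\rho_a\le\rho_b$. Let $\mathrm{pf}_n(123,132,213)$ be the number of parking functions $p$ of size $n$ such that $\phi(p)$ avoids each of the patterns $123$, $132$ and $213$. \textbf{Theorem.} For every integer $n\ge 0$, $\mathrm{pf}_n(123,132,213)$ is equal to the number of rooted ordered trees with $n+1$ edges in which every vertex is a leaf or adjacent to a leaf, where a leaf is a vertex without children (so the root of a tree with at least one edge is not a leaf). -/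

import Mathlib

namespace PatternParking

/-! ### Patterns in words -/

/-- The word `w` contains the pattern `ρ`: there are positions `i₁ < ⋯ < iₘ` of `w`
(where `m` is the length of `ρ`) such that `w` at `i_a` is at most `w` at `i_b` if and only if
`ρ_a ≤ ρ_b`. -/
def Contains (w ρ : List ℕ) : Prop :=
  ∃ f : Fin ρ.length → Fin w.length, StrictMono f ∧
    ∀ a b : Fin ρ.length, w.get (f a) ≤ w.get (f b) ↔ ρ.get a ≤ ρ.get b

/-- The word `w` avoids the pattern `ρ`. -/
def Avoids (w ρ : List ℕ) : Prop := ¬ Contains w ρ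

/-! ### Parking functions as labeled Dyck paths -/

/-- A step of a labeled lattice path: a north step carrying a label, or an east step. -/
inductive Step : Type
  | north (label : ℕ) : Step
  | east : Step

/-- The label of a north step. -/
def Step.label? : Step → Option ℕ
  | .north a => some a
  | .east => none

/-- Is the step an east step? -/
def Step.isEast : Step → Bool
  | .north _ => false
  | .east => true

/-- The word of the labels of the north steps of a path, in the order of the path. -/
def labels (p : List Step) : List ℕ := p.filterMap Step.label?

/-- The number of north steps of a path. -/
def numNorth (p : List Step) : ℕ := p.countP (fun s => !s.isEast)

/-- The number of east steps of a path. -/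
def numEast (p : List Step) : ℕ := p.countP Step.isEast

/-- `p` is a parking function of size `n`, represented as a labeled Dyck path: a lattice path from
`(0,0)` to `(n,n)` with north and east steps that never goes below the line `y = x`, whose north
steps are labeled bijectively by `1, …, n`, with labels increasing along consecutive north
steps. -/
structure IsParkingFunction (n : ℕ) (p : List Step) : Prop where
  numNorth_eq : numNorth p = n
  numEast_eq : numEast p = n
  numEast_le : ∀ q : List Step, q <+: p → numEast q ≤ numNorth q
  labels_perm : (labels p).Perm (List.range' 1 n)
  increasing : ∀ (q r : List Step) (a b : ℕ), p = q ++ .north a :: .north b :: r → a < b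

/-- The number of parking functions `p` of size `n` such that the permutation obtained by reading
the labels of the north steps of `p` in order avoids every pattern of the list `P`. -/
noncomputable def pf (n : ℕ) (P : List (List ℕ)) : ℕ :=
  Set.ncard {p : List Step | IsParkingFunction n p ∧ ∀ ρ ∈ P, Avoids (labels p) ρ}

/-! ### Rooted ordered trees -/

/-- A (finite, nonempty) rooted ordered tree: a root with the list of the subtrees hanging from
it. -/
inductive OrderedTree : Type
  | node (children : List OrderedTree) : OrderedTree

namespace OrderedTree

/-- The subtrees hanging from the root, from left to right. -/
def children : OrderedTree → List OrderedTree
  | node cs => cs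

/-- The number of edges: every child of the root contributes the edge to the root and the edges
of its own subtree. -/
def numEdges : OrderedTree → ℕ
  | node cs => (cs.map (fun t => numEdges t + 1)).sum

/-- The subtree below the vertex with a given address, if there is such a vertex. The root has the
empty address, and the `i`-th child (from `0`) of the vertex with address `v` has address
`v ++ [i]`. -/
def subtreeAt : OrderedTree → List ℕ → Option OrderedTree
  | t, [] => some t
  | t, i :: v => t.children[i]?.bind (fun s => subtreeAt s v)

/-- The vertices of a tree, given by their addresses. -/
def IsVertex (t : OrderedTree) (v : List ℕ) : Prop := ∃ s, t.subtreeAt v = some s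

/-- A leaf is a vertex without children. -/
def IsLeaf (t : OrderedTree) (v : List ℕ) : Prop :=
  t.IsVertex v ∧ ∀ i : ℕ, ¬ t.IsVertex (v ++ [i])

/-- Two vertices are adjacent if one of them is a child of the other. -/
def Adj (t : OrderedTree) (u v : List ℕ) : Prop :=
  t.IsVertex u ∧ t.IsVertex v ∧ ∃ i : ℕ, v = u ++ [i] ∨ u = v ++ [i]

end OrderedTree

end PatternParking

/-!
Avoiding `123`, `132` and `213` forces every label to exceed all later ones except possibly the
next, so the labels form a decreasing sequence of blocks of one or two consecutive integers. In
such a parking function, the north step that ends a block is followed by an east step. Merging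
these two steps into a flat step gives a Motzkin path, from which the labels can be recovered. The
Motzkin paths that arise are those in which, after an up step, a flat step comes before the next
up step and before the end.

Deleting the root of a tree in which every vertex is a leaf or adjacent to a leaf leaves a forest
in which a leaf hangs from the deleted root and from every other vertex with children. The arch
decompositions of Motzkin paths build up these forests tree by tree, once one includes the forests
without a single-vertex tree. The paths of the latter are segments of the paths above: at both ends
of the segment, some up step still awaits its flat step.
-/

namespace PatternParking

/-! ### Excursions -/

section Excursion

variable {α : Type*} (f : α → ℤ)

/-- The walk from height `h` whose steps have rises `f x`, for `x` in `l`, never goes below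
height `0`. -/
def StaysNonneg (h : ℤ) (l : List α) : Prop := ∀ u, u <+: l → 0 ≤ h + (u.map f).sum

/-- The walk from height `0` whose steps have rises `f x`, for `x` in `l`, ends at height `0` and
never goes below it. This covers both Dyck and Motzkin paths. -/
def IsExcursion (l : List α) : Prop := StaysNonneg f 0 l ∧ (l.map f).sum = 0

variable {f} {h : ℤ} {l u v : List α}

theorem staysNonneg_nil : StaysNonneg f h [] ↔ 0 ≤ h := by
  simp [StaysNonneg]

theorem staysNonneg_cons {x : α} :
    StaysNonneg f h (x :: l) ↔ 0 ≤ h ∧ StaysNonneg f (h + f x) l := by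
  constructor
  · exact fun H => ⟨by simpa using H [] List.nil_prefix,
      fun u hu => by simpa [add_assoc] using H (x :: u) (List.prefix_cons_inj x |>.2 hu)⟩
  · rintro ⟨hh, H⟩ u hu
    rcases List.prefix_cons_iff.1 hu with rfl | ⟨v, rfl, hv⟩
    · simpa using hh
    · simpa [add_assoc] using H v hv

theorem staysNonneg_append :
    StaysNonneg f h (u ++ v) ↔ StaysNonneg f h u ∧ StaysNonneg f (h + (u.map f).sum) v := by
  induction u generalizing h with
  | nil =>
    simpa [staysNonneg_nil] using fun hv : StaysNonneg f h v => by simpa using hv [] List.nil_prefix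
  | cons x u ih => simp [staysNonneg_cons, ih, and_assoc, add_assoc]

theorem StaysNonneg.mono {k : ℤ} (hl : StaysNonneg f h l) (hk : h ≤ k) : StaysNonneg f k l :=
  fun u hu => (hl u hu).trans (by gcongr)

theorem IsExcursion.nil : IsExcursion f [] := by
  simp [IsExcursion, staysNonneg_nil]

theorem IsExcursion.append (hu : IsExcursion f u) (hv : IsExcursion f v) :
    IsExcursion f (u ++ v) := by
  simp_all [IsExcursion, staysNonneg_append]

theorem IsExcursion.arch {a b : α} (hv : IsExcursion f v) (ha : f a = 1) (hb : f b = -1) :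
    IsExcursion f (a :: v ++ [b]) := by
  have hv' : StaysNonneg f 1 v := hv.1.mono zero_le_one
  simp_all [IsExcursion, staysNonneg_append, staysNonneg_cons, staysNonneg_nil]

theorem isExcursion_cons_of_eq_zero {x : α} (hx : f x = 0) :
    IsExcursion f (x :: l) ↔ IsExcursion f l := by
  simp [IsExcursion, staysNonneg_cons, hx]

theorem isExcursion_concat_of_eq_zero {x : α} (hx : f x = 0) :
    IsExcursion f (l ++ [x]) ↔ IsExcursion f l := by
  have hend : StaysNonneg f 0 l → 0 ≤ (l.map f).sum := fun H => by simpa using H l List.prefix_rfl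
  simpa [IsExcursion, staysNonneg_append, staysNonneg_cons, staysNonneg_nil, hx] using
    fun _ H => hend H

/-- If the second decomposition had the later step `x`, then that step would lie on `v`, and `v`
would pass below its starting height just before it. -/
theorem IsExcursion.append_cons_inj {x : α} (hx : f x = 1) {u' v' : List α}
    (hu : IsExcursion f u) (hv : IsExcursion f v) (hu' : IsExcursion f u') (hv' : IsExcursion f v')
    (h : u ++ x :: v = u' ++ x :: v') : u = u' ∧ v = v' := by
  wlog hle : u.length ≤ u'.length generalizing u v u' v'
  · exact (this hu' hv' hu hv h.symm (by omega)).imp Eq.symm Eq.symm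
  obtain ⟨a, rfl⟩ := List.prefix_of_prefix_length_le ⟨_, h⟩ (List.prefix_append _ _) hle
  cases a with
  | nil => simpa using h
  | cons y a =>
    simp only [List.append_assoc, List.append_cancel_left_eq, List.cons_append,
      List.cons.injEq] at h
    obtain ⟨rfl, rfl⟩ := h
    have hpos := hv.1 a (List.prefix_append _ _)
    have hsum := hu'.2
    simp only [List.map_append, List.map_cons, List.sum_append, List.sum_cons, hu.2, hx] at hsum
    omega

end Excursion

/-! ### Motzkin paths -/

/-- A step of a Motzkin path. -/
inductive MotzkinStep : Type
  | up : MotzkinStep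
  | flat : MotzkinStep
  | down : MotzkinStep

namespace MotzkinStep

/-- The height gained by a step. -/
def rise : MotzkinStep → ℤ
  | up => 1
  | flat => 0
  | down => -1

/-- Is the step an up or a flat step? These are the steps that stand for a car. -/
def isCar : MotzkinStep → Bool
  | up => true
  | flat => true
  | down => false

end MotzkinStep

open MotzkinStep

/-- The number of steps of a Motzkin path that stand for a car. -/
def numCars (w : List MotzkinStep) : ℕ := w.countP isCar

theorem numCars_cons (x : MotzkinStep) (w : List MotzkinStep) :
    numCars (x :: w) = numCars w + if x.isCar then 1 else 0 :=
  List.countP_cons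

theorem exists_last_up (w : List MotzkinStep) (hw : StaysNonneg rise 0 w)
    (hpos : 0 < (w.map rise).sum) :
    ∃ u v, w = u ++ up :: v ∧ StaysNonneg rise 0 u ∧ IsExcursion rise v := by
  induction hn : w.length using Nat.strong_induction_on generalizing w with
  | _ n ih =>
  rcases List.eq_nil_or_concat' w with rfl | ⟨w, x, rfl⟩
  · simp at hpos
  have hw' := (staysNonneg_append.1 hw).1
  simp only [List.map_append, List.sum_append, List.map_cons, List.map_nil, List.sum_singleton,
    List.length_append, List.length_singleton] at hpos hn
  cases x with
  | up => exact ⟨w, [], by simp, hw', .nil⟩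
  | flat =>
    obtain ⟨u, v, rfl, hu, hv⟩ := ih _ (by omega) w hw' (by simpa [rise] using hpos) rfl
    exact ⟨u, v ++ [flat], by simp, hu, (isExcursion_concat_of_eq_zero (x := flat) rfl).2 hv⟩
  | down =>
    simp only [rise] at hpos
    obtain ⟨u, v, rfl, hu, hv⟩ := ih _ (by omega) w hw' (by omega) rfl
    have hupos : 0 < (u.map rise).sum := by
      simp only [List.map_append, List.sum_append, List.map_cons, List.sum_cons, hv.2, rise] at hpos
      omega
    obtain ⟨u, v', rfl, hu, hv'⟩ := ih _ (by simp at hn ⊢; omega) u hu hupos rfl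
    exact ⟨u, v' ++ (up :: v ++ [down]), by simp, hu, hv'.append (hv.arch rfl rfl)⟩

theorem IsExcursion.eq_nil_or_flat_or_arch {w : List MotzkinStep} (hw : IsExcursion rise w) :
    w = [] ∨ (∃ u, w = u ++ [flat] ∧ IsExcursion rise u) ∨
      ∃ u v, w = u ++ up :: v ++ [down] ∧ IsExcursion rise u ∧ IsExcursion rise v := by
  rcases List.eq_nil_or_concat' w with rfl | ⟨w, x, rfl⟩
  · exact .inl rfl
  obtain ⟨hstay, hsum⟩ := hw
  have hstay' := (staysNonneg_append.1 hstay).1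
  have hnonneg : 0 ≤ (w.map rise).sum := by simpa using hstay' w List.prefix_rfl
  simp only [List.map_append, List.sum_append, List.map_cons, List.map_nil,
    List.sum_singleton] at hsum
  cases x with
  | up => simp only [rise] at hsum; omega
  | flat => exact .inr (.inl ⟨w, rfl, hstay', by simpa [rise] using hsum⟩)
  | down =>
    simp only [rise] at hsum
    obtain ⟨u, v, rfl, hu, hv⟩ := exists_last_up w hstay' (by omega)
    refine .inr (.inr ⟨u, v, rfl, ⟨hu, ?_⟩, hv⟩)
    simp only [List.map_append, List.sum_append, List.map_cons, List.sum_cons, hv.2, rise] at hsum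
    omega

/-- The phase of a reader of a Motzkin path: `pending` after an up step that has not been followed
by a flat step yet, and `ready` otherwise. -/
inductive Phase : Type
  | ready : Phase
  | pending : Phase
  deriving DecidableEq

namespace Phase

/-- The phase after one more step; two up steps without a flat step in between are forbidden. -/
def next : Phase → MotzkinStep → Option Phase
  | s, .down => some s
  | _, .flat => some ready
  | ready, .up => some pending
  | pending, .up => none

/-- The phase after a path, or `none` if the path is forbidden. -/
def run (s : Phase) (w : List MotzkinStep) : Option Phase := w.foldlM next s

theorem run_nil (s : Phase) : s.run [] = some s := rfl

theorem run_cons (s : Phase) (x : MotzkinStep) (w : List MotzkinStep) :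
    s.run (x :: w) = (s.next x).bind fun t => t.run w :=
  List.foldlM_cons

theorem run_append (s : Phase) (u v : List MotzkinStep) :
    s.run (u ++ v) = (s.run u).bind fun t => t.run v :=
  List.foldlM_append

theorem run_append_eq_some {s t : Phase} {u v : List MotzkinStep} :
    s.run (u ++ v) = some t ↔ ∃ r, s.run u = some r ∧ r.run v = some t := by
  rw [run_append, Option.bind_eq_some_iff]

theorem run_concat_flat (s : Phase) (w : List MotzkinStep) :
    s.run (w ++ [flat]) = (s.run w).map fun _ => ready := by
  rw [run_append, Option.map_eq_bind]
  rfl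

theorem run_arch_eq_some {s t : Phase} {u v : List MotzkinStep}
    (h : s.run (u ++ up :: v ++ [down]) = some t) :
    s.run u = some ready ∧ pending.run v = some t := by
  obtain ⟨r, hr, hdown⟩ := run_append_eq_some.1 h
  obtain rfl : r = t := by simpa [run_cons, run_nil, next] using hdown
  obtain ⟨q, hu, hv⟩ := run_append_eq_some.1 hr
  cases q with
  | ready => exact ⟨hu, by simpa [run_cons, next] using hv⟩
  | pending => simp [run_cons, next] at hv

theorem eq_nil_or_flat_of_pending_run {s : Phase} {w : List MotzkinStep} (hw : IsExcursion rise w)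
    (hr : pending.run w = some s) :
    w = [] ∨ ∃ v, w = flat :: v ∧ IsExcursion rise v ∧ ready.run v = some s := by
  cases w with
  | nil => exact .inl rfl
  | cons x w =>
    cases x with
    | up => simp [run_cons, next] at hr
    | flat =>
      exact .inr ⟨w, rfl, (isExcursion_cons_of_eq_zero (x := flat) rfl).1 hw,
        by simpa [run_cons, next] using hr⟩
    | down => simpa [rise] using hw.1 [down] (by simp)

theorem eq_nil_or_flat_arch_of_pending_run {w : List MotzkinStep} (hw : IsExcursion rise w)
    (hr : pending.run w = some pending) :
    w = [] ∨ ∃ u v, w = flat :: (u ++ up :: v ++ [down]) ∧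
      IsExcursion rise u ∧ ready.run u = some ready ∧
      IsExcursion rise v ∧ pending.run v = some pending := by
  rcases eq_nil_or_flat_of_pending_run hw hr with rfl | ⟨w, rfl, hw, hr⟩
  · exact .inl rfl
  rcases hw.eq_nil_or_flat_or_arch with rfl | ⟨u, rfl, -⟩ | ⟨u, v, rfl, hu, hv⟩
  · simp [run_nil] at hr
  · simp [run_concat_flat] at hr
  · obtain ⟨hru, hrv⟩ := run_arch_eq_some hr
    exact .inr ⟨u, v, rfl, hu, hru, hv, hrv⟩

@[elab_as_elim]
theorem run_eq_ready_induction {motive : (s : Phase) → (w : List MotzkinStep) →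
      s.run w = some ready → Prop} (nil : motive ready [] rfl)
    (up : ∀ w (hr : pending.run w = some ready), motive pending w hr → motive ready (.up :: w) hr)
    (flat : ∀ s w (hr : ready.run w = some ready), motive ready w hr →
      motive s (.flat :: w) (by cases s <;> exact hr))
    (down : ∀ s w (hr : s.run w = some ready), motive s w hr →
      motive s (.down :: w) (by cases s <;> exact hr))
    {s : Phase} {w : List MotzkinStep} (hr : s.run w = some ready) : motive s w hr := by
  induction w generalizing s with
  | nil =>
    cases hr
    exact nil
  | cons x w ih =>
    obtain ⟨t, ht, hw⟩ := Option.bind_eq_some_iff.1 ((run_cons s x w).symm.trans hr)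
    cases s <;> cases x <;> cases ht
    exacts [up w hw (ih hw), flat _ w hw (ih hw), down _ w hw (ih hw), flat _ w hw (ih hw),
      down _ w hw (ih hw)]

end Phase

open Phase

/-! ### Forests as Motzkin paths -/

/-- An ordered forest whose trees have, at every vertex with children, a leaf among the children.
The index is `ready` if a tree of the forest is a single vertex and `pending` otherwise. -/
inductive LeafyForest : Phase → Type
  | nil : LeafyForest .pending
  | leaf {s : Phase} : LeafyForest s → LeafyForest .ready
  | node {s : Phase} : LeafyForest .ready → LeafyForest s → LeafyForest s

namespace LeafyForest

/-- The Motzkin path of a forest, which leads from the phase of the forest to the same phase. A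
nonempty path of a forest in phase `pending` starts with a flat step; moving this step to the end
yields a path from `ready` to `ready` whose last step is read in phase `pending`. -/
def toMotzkin : {s : Phase} → LeafyForest s → List MotzkinStep
  | _, nil => []
  | _, leaf (s := .ready) c => c.toMotzkin ++ [flat]
  | _, leaf (s := .pending) c => c.toMotzkin.rotate 1
  | .ready, node a c => c.toMotzkin ++ up :: (flat :: a.toMotzkin) ++ [down]
  | .pending, node a c => flat :: (a.toMotzkin ++ up :: c.toMotzkin ++ [down])

theorem toMotzkin_pending (c : LeafyForest .pending) :
    c.toMotzkin = [] ∨ ∃ w, c.toMotzkin = flat :: w := by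
  cases c <;> simp [toMotzkin]

theorem isExcursion_toMotzkin {s : Phase} (c : LeafyForest s) : IsExcursion rise c.toMotzkin := by
  induction c with
  | nil => exact .nil
  | @leaf s c ih =>
    cases s with
    | ready => exact (isExcursion_concat_of_eq_zero (x := flat) rfl).2 ih
    | pending =>
      rcases c.toMotzkin_pending with hc | ⟨w, hc⟩ <;> rw [toMotzkin, hc]
      · exact .nil
      · rw [hc, isExcursion_cons_of_eq_zero (x := flat) rfl] at ih
        simpa using (isExcursion_concat_of_eq_zero (x := flat) rfl).2 ih
  | @node s a c iha ihc =>
    have ha : IsExcursion rise (flat :: a.toMotzkin) :=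
      (isExcursion_cons_of_eq_zero (x := flat) rfl).2 iha
    cases s with
    | ready => simpa [toMotzkin] using ihc.append (ha.arch (a := up) (b := down) rfl rfl)
    | pending => simpa [toMotzkin] using ha.append (ihc.arch (a := up) (b := down) rfl rfl)

theorem run_toMotzkin {s : Phase} (c : LeafyForest s) : s.run c.toMotzkin = some s := by
  induction c with
  | nil => rfl
  | @leaf s c ih =>
    cases s with
    | ready => simp [toMotzkin, run_append, ih, run_cons, next, run_nil]
    | pending =>
      rcases c.toMotzkin_pending with hc | ⟨w, hc⟩ <;> rw [toMotzkin, hc]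
      · rfl
      · have hw : ready.run w = some pending := by simpa [hc, run_cons, next] using ih
        simp [run_append, hw, run_cons, next, run_nil]
  | @node s a c iha ihc =>
    cases s <;> simp [toMotzkin, run_append, run_cons, next, run_nil, iha, ihc]

theorem toMotzkin_leaf {s : Phase} (c : LeafyForest s) :
    c.leaf.toMotzkin = [] ∨ ∃ w, c.leaf.toMotzkin = w ++ [flat] := by
  cases s with
  | ready => simp [toMotzkin]
  | pending => rcases c.toMotzkin_pending with hc | ⟨w, hc⟩ <;> simp [toMotzkin, hc]

theorem toMotzkin_leaf_ne_toMotzkin_node {s : Phase} (c : LeafyForest s)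
    (a d : LeafyForest .ready) : c.leaf.toMotzkin ≠ (node a d).toMotzkin := by
  have hlast : (node a d).toMotzkin.getLast? = some down := List.getLast?_concat
  rcases c.toMotzkin_leaf with hc | ⟨w, hc⟩ <;> rw [hc] <;> rintro h <;> simp [← h] at hlast

theorem toMotzkin_leaf_ready_ne (c : LeafyForest .ready) (d : LeafyForest .pending) :
    c.leaf.toMotzkin ≠ d.leaf.toMotzkin := by
  intro h
  have hd := d.run_toMotzkin
  rcases d.toMotzkin_pending with h' | ⟨w, h'⟩ <;> simp only [toMotzkin, h'] at h
  · simp at h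
  · obtain rfl : c.toMotzkin = w := by simpa using h
    simp [h', run_cons, next, c.run_toMotzkin] at hd

theorem toMotzkin_injective {s : Phase} :
    Function.Injective (toMotzkin : LeafyForest s → List MotzkinStep) := by
  intro c c' h
  induction c with
  | nil => cases c' <;> simp_all [toMotzkin]
  | @leaf s c ih =>
    cases c' with
    | @leaf t d =>
      cases s <;> cases t
      · rw [ih (List.append_cancel_right h)]
      · exact (toMotzkin_leaf_ready_ne _ _ h).elim
      · exact (toMotzkin_leaf_ready_ne _ _ h.symm).elim
      · rw [ih (List.rotate_injective 1 h)]
    | node a d => exact (toMotzkin_leaf_ne_toMotzkin_node _ _ _ h).elim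
  | @node s a c iha ihc =>
    cases c' with
    | nil => simp [toMotzkin] at h
    | leaf d => exact (toMotzkin_leaf_ne_toMotzkin_node _ _ _ h.symm).elim
    | node b d =>
      have ha := a.isExcursion_toMotzkin
      have hb := b.isExcursion_toMotzkin
      have hc := c.isExcursion_toMotzkin
      have hd := d.isExcursion_toMotzkin
      cases s with
      | ready =>
        obtain ⟨h₁, h₂⟩ := hc.append_cons_inj (x := up) rfl
          ((isExcursion_cons_of_eq_zero (x := flat) rfl).2 ha) hd
          ((isExcursion_cons_of_eq_zero (x := flat) rfl).2 hb) (List.append_cancel_right h)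
        rw [ihc h₁, iha (List.cons_injective h₂)]
      | pending =>
        obtain ⟨h₁, h₂⟩ := ha.append_cons_inj (x := up) rfl hc hb hd
          (List.append_cancel_right (List.cons_injective h))
        rw [iha h₁, ihc h₂]

theorem exists_toMotzkin_eq {s : Phase} {w : List MotzkinStep} (hw : IsExcursion rise w)
    (hr : s.run w = some s) : ∃ c : LeafyForest s, c.toMotzkin = w := by
  induction hn : w.length using Nat.strong_induction_on generalizing s w with
  | _ n ih =>
  have exists_pending {w : List MotzkinStep} (hn : w.length = n) (hw : IsExcursion rise w)
      (hr : pending.run w = some pending) : ∃ c : LeafyForest pending, c.toMotzkin = w := by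
    rcases eq_nil_or_flat_arch_of_pending_run hw hr with
      rfl | ⟨u, v, rfl, hu, hru, hv, hrv⟩
    · exact ⟨nil, rfl⟩
    · simp only [List.length_append, List.length_cons, List.length_nil] at hn
      obtain ⟨a, rfl⟩ := ih _ (by omega) hu hru rfl
      obtain ⟨c, rfl⟩ := ih _ (by omega) hv hrv rfl
      exact ⟨node a c, rfl⟩
  cases s with
  | pending => exact exists_pending hn hw hr
  | ready =>
    rcases hw.eq_nil_or_flat_or_arch with rfl | ⟨u, rfl, hu⟩ | ⟨u, v, rfl, hu, hv⟩
    · exact ⟨leaf nil, rfl⟩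
    · obtain ⟨t, hru, -⟩ := run_append_eq_some.1 hr
      simp only [List.length_append, List.length_cons, List.length_nil] at hn
      cases t with
      | ready =>
        obtain ⟨c, rfl⟩ := ih _ (by omega) hu hru rfl
        exact ⟨leaf c, rfl⟩
      | pending =>
        obtain ⟨c, hc⟩ := exists_pending (w := flat :: u) (by simpa using hn)
          ((isExcursion_cons_of_eq_zero (x := flat) rfl).2 hu) (by simpa [run_cons, next] using hru)
        exact ⟨leaf c, by simp [toMotzkin, hc]⟩
    · obtain ⟨hru, hrv⟩ := run_arch_eq_some hr
      simp only [List.length_append, List.length_cons, List.length_nil] at hn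
      rcases eq_nil_or_flat_of_pending_run hv hrv with rfl | ⟨v, rfl, hv, hrv⟩
      · simp [run_nil] at hrv
      obtain ⟨c, rfl⟩ := ih _ (by omega) hu hru rfl
      obtain ⟨a, rfl⟩ := ih _ (by simp at hn; omega) hv hrv rfl
      exact ⟨node a c, rfl⟩

end LeafyForest

/-! ### Trees as forests -/

namespace OrderedTree

theorem subtreeAt_nil (t : OrderedTree) : t.subtreeAt [] = some t := by
  rw [subtreeAt]

theorem subtreeAt_cons (t : OrderedTree) (i : ℕ) (v : List ℕ) :
    t.subtreeAt (i :: v) = t.children[i]?.bind fun s => s.subtreeAt v := by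
  rw [subtreeAt]

theorem subtreeAt_concat (t : OrderedTree) (v : List ℕ) (i : ℕ) :
    t.subtreeAt (v ++ [i]) = (t.subtreeAt v).bind fun s => s.children[i]? := by
  induction v generalizing t with
  | nil =>
    rw [List.nil_append, subtreeAt_cons, subtreeAt_nil, Option.bind_some]
    simp [subtreeAt_nil]
  | cons j v ih => simp only [List.cons_append, subtreeAt_cons, ih, Option.bind_assoc]

theorem isLeaf_iff {t : OrderedTree} {v : List ℕ} :
    t.IsLeaf v ↔ t.subtreeAt v = some (node []) := by
  constructor
  · rintro ⟨⟨⟨cs⟩, hs⟩, h⟩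
    cases cs with
    | nil => exact hs
    | cons c cs => exact absurd ⟨c, by simp [subtreeAt_concat, hs, children]⟩ (h 0)
  · intro h
    refine ⟨⟨_, h⟩, ?_⟩
    rintro i ⟨s, hs⟩
    simp [subtreeAt_concat, h, children] at hs

/-- Every vertex of the tree is a leaf or adjacent to a leaf. -/
def LeafDominated (t : OrderedTree) : Prop :=
  ∀ v : List ℕ, t.IsVertex v → t.IsLeaf v ∨ ∃ u : List ℕ, t.Adj v u ∧ t.IsLeaf u

theorem leafDominated_iff_subtreeAt {t : OrderedTree} :
    t.LeafDominated ↔ ∀ v s, t.subtreeAt v = some s → s = node [] ∨ node [] ∈ s.children := by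
  refine forall_congr' fun v => ?_
  constructor
  · intro h s hs
    rcases h ⟨s, hs⟩ with h | ⟨u, ⟨hv, hu, i, rfl | rfl⟩, hl⟩
    · rw [isLeaf_iff, hs] at h
      exact .inl (Option.some.inj h)
    · rw [isLeaf_iff, subtreeAt_concat, hs] at hl
      exact .inr (List.mem_of_getElem? hl)
    · exact absurd hv (hl.2 i)
  · rintro h ⟨s, hs⟩
    rcases h s hs with rfl | h
    · exact .inl (isLeaf_iff.2 hs)
    · obtain ⟨i, hi⟩ := List.mem_iff_getElem?.1 h
      have hu : t.subtreeAt (v ++ [i]) = some (node []) := by rwa [subtreeAt_concat, hs]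
      exact .inr ⟨v ++ [i], ⟨⟨s, hs⟩, ⟨_, hu⟩, i, .inl rfl⟩, isLeaf_iff.2 hu⟩

theorem leafDominated_node {cs : List OrderedTree} :
    (node cs).LeafDominated ↔ (cs = [] ∨ node [] ∈ cs) ∧ ∀ t ∈ cs, t.LeafDominated := by
  simp only [leafDominated_iff_subtreeAt]
  constructor
  · refine fun h => ⟨by simpa [children] using h [] _ (subtreeAt_nil _), fun t ht v s hs => ?_⟩
    obtain ⟨i, hi⟩ := List.mem_iff_getElem?.1 ht
    exact h (i :: v) s (by rwa [subtreeAt_cons, children, hi])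
  · rintro ⟨hroot, hcs⟩ (_ | ⟨i, v⟩) s hs
    · obtain rfl : node cs = s := by simpa [subtreeAt_nil] using hs
      simpa [children] using hroot
    · rw [subtreeAt_cons, Option.bind_eq_some_iff] at hs
      obtain ⟨t, ht, hs⟩ := hs
      exact hcs t (List.mem_of_getElem? ht) v s hs

theorem numEdges_nil : numEdges (node []) = 0 := by
  rw [numEdges]; rfl

theorem numEdges_cons (t : OrderedTree) (ts : List OrderedTree) :
    numEdges (node (t :: ts)) = numEdges t + 1 + numEdges (node ts) := by
  rw [numEdges, numEdges]; simp

end OrderedTree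

open OrderedTree

namespace LeafyForest

/-- The trees of a forest, from left to right. -/
def toForest : {s : Phase} → LeafyForest s → List OrderedTree
  | _, nil => []
  | _, leaf c => .node [] :: c.toForest
  | _, node a c => .node a.toForest :: c.toForest

theorem leaf_mem_toForest {s : Phase} (c : LeafyForest s) :
    .node [] ∈ c.toForest ↔ s = ready := by
  induction c with
  | nil => simp [toForest]
  | leaf c _ => simp [toForest]
  | node a c iha ihc =>
    have ha : [] ≠ a.toForest := fun h => by simp [← h] at iha
    simp [toForest, ihc, ha]

theorem toForest_ne_nil (c : LeafyForest ready) : c.toForest ≠ [] :=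
  List.ne_nil_of_mem (c.leaf_mem_toForest.2 rfl)

theorem phase_eq_of_toForest_eq {s t : Phase} {c : LeafyForest s} {d : LeafyForest t}
    (h : c.toForest = d.toForest) : s = t := by
  have := c.leaf_mem_toForest
  rw [h, d.leaf_mem_toForest] at this
  cases s <;> cases t <;> simp_all

theorem toForest_injective {s : Phase} :
    Function.Injective (toForest : LeafyForest s → List OrderedTree) := by
  intro c c' h
  induction c with
  | nil => cases c' with
    | nil => rfl
    | node b d => simp [toForest] at h
  | leaf c ih =>
    cases c' with
    | leaf d =>
      have hcd := List.cons_injective h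
      obtain rfl := phase_eq_of_toForest_eq hcd
      rw [ih hcd]
    | node b d => simp [toForest, b.toForest_ne_nil.symm] at h
  | node a c iha ihc =>
    cases c' with
    | nil => simp [toForest] at h
    | leaf d => simp [toForest, a.toForest_ne_nil] at h
    | node b d =>
      simp only [toForest, List.cons.injEq, OrderedTree.node.injEq] at h
      rw [iha h.1, ihc h.2]

theorem leafDominated_of_mem_toForest {s : Phase} {c : LeafyForest s} {t : OrderedTree}
    (ht : t ∈ c.toForest) : t.LeafDominated := by
  induction c generalizing t with
  | nil => simp [toForest] at ht
  | leaf c ih =>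
    rcases List.mem_cons.1 ht with rfl | ht
    · simp [leafDominated_node]
    · exact ih ht
  | node a c iha ihc =>
    rcases List.mem_cons.1 ht with rfl | ht
    · exact leafDominated_node.2 ⟨.inr (a.leaf_mem_toForest.2 rfl), fun t => iha⟩
    · exact ihc ht

theorem exists_toForest_eq (ts : List OrderedTree) (h : ∀ t ∈ ts, t.LeafDominated) :
    ∃ (s : Phase) (c : LeafyForest s), c.toForest = ts := by
  induction hn : numEdges (.node ts) using Nat.strong_induction_on generalizing ts with
  | _ n ih =>
  rcases ts with _ | ⟨⟨cs⟩, ts⟩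
  · exact ⟨_, nil, rfl⟩
  rw [numEdges_cons] at hn
  obtain ⟨hcs, hts⟩ := List.forall_mem_cons.1 h
  obtain ⟨hroot, hcs⟩ := leafDominated_node.1 hcs
  obtain ⟨s, c, rfl⟩ := ih _ (by omega) ts hts rfl
  obtain ⟨t, a, rfl⟩ := ih _ (by omega) cs hcs rfl
  rcases hroot with ha | ha
  · exact ⟨_, leaf c, by rw [toForest, ha]⟩
  · obtain rfl := a.leaf_mem_toForest.1 ha
    exact ⟨s, node a c, rfl⟩

theorem numCars_leaf {s : Phase} (c : LeafyForest s) :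
    numCars c.leaf.toMotzkin = numCars c.toMotzkin + if s = ready then 1 else 0 := by
  cases s with
  | ready => simp [toMotzkin, numCars, isCar]
  | pending => simpa [toMotzkin, numCars] using (List.rotate_perm _ 1).countP_eq isCar

theorem numCars_node {s : Phase} (a : LeafyForest ready) (c : LeafyForest s) :
    numCars (node a c).toMotzkin = numCars a.toMotzkin + numCars c.toMotzkin + 2 := by
  cases s <;> simp [toMotzkin, numCars, isCar, List.countP_cons] <;> omega

theorem numEdges_toForest {s : Phase} (c : LeafyForest s) :
    numEdges (.node c.toForest) = numCars c.toMotzkin + if s = ready then 1 else 0 := by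
  induction c with
  | nil => simp [toForest, numEdges_nil, toMotzkin, numCars]
  | leaf c ih => rw [toForest, numEdges_cons, numEdges_nil, ih, numCars_leaf]; simp; omega
  | node a c iha ihc => rw [toForest, numEdges_cons, iha, ihc, numCars_node]; simp; omega

end LeafyForest

theorem ncard_leafDominated_trees (n : ℕ) :
    Set.ncard {t : OrderedTree | t.numEdges = n + 1 ∧ t.LeafDominated} =
      Set.ncard {c : LeafyForest ready | numCars c.toMotzkin = n} := by
  have hinj : Function.Injective fun c : LeafyForest ready => OrderedTree.node c.toForest :=
    fun c c' h => LeafyForest.toForest_injective (OrderedTree.node.inj h)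
  rw [← Set.ncard_image_of_injective _ hinj]
  congr 1
  ext ⟨cs⟩
  simp only [Set.mem_ofPred_eq, Set.mem_image, OrderedTree.node.injEq, leafDominated_node]
  constructor
  · rintro ⟨hn, hroot, hcs⟩
    obtain ⟨s, c, rfl⟩ := LeafyForest.exists_toForest_eq cs hcs
    have hs : s = ready := by
      rw [c.leaf_mem_toForest] at hroot
      refine hroot.resolve_left fun h => ?_
      simp [h, numEdges_nil] at hn
    subst hs
    exact ⟨c, by simpa [c.numEdges_toForest] using hn, rfl⟩
  · rintro ⟨c, rfl, rfl⟩
    exact ⟨by simp [c.numEdges_toForest], .inr (c.leaf_mem_toForest.2 rfl),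
      fun t => LeafyForest.leafDominated_of_mem_toForest⟩

/-! ### Layered words -/

/-- A decreasing sequence of blocks of one or two letters, in which the letters of a block are
consecutive integers in increasing order. -/
inductive Layered : List ℕ → Prop
  | nil : Layered []
  | one {l : List ℕ} : Layered l → Layered ((l.length + 1) :: l)
  | two {l : List ℕ} : Layered l → Layered ((l.length + 1) :: (l.length + 2) :: l)

theorem cons_length_perm_range' {l : List ℕ} :
    ((l.length + 1) :: l).Perm (List.range' 1 (l.length + 1)) ↔
      l.Perm (List.range' 1 l.length) := by
  rw [List.range'_1_concat, Nat.add_comm 1, (List.perm_append_singleton _ _).congr_right,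
    List.perm_cons]

theorem perm_range'_of_cons_of_forall_lt {a : ℕ} {l : List ℕ}
    (h : (a :: l).Perm (List.range' 1 (l.length + 1))) (hlt : ∀ x ∈ l, x < a) :
    a = l.length + 1 ∧ l.Perm (List.range' 1 l.length) := by
  have hle : a ≤ l.length + 1 := by
    have := h.mem_iff.1 List.mem_cons_self
    rw [List.mem_range'_1] at this
    omega
  have hmem : l.length + 1 ∈ a :: l := h.mem_iff.2 (by simp [List.mem_range'_1])
  obtain rfl : a = l.length + 1 := by
    rcases List.mem_cons.1 hmem with h | h
    · exact h.symm
    · exact hle.antisymm (hlt _ h).le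
  exact ⟨rfl, cons_length_perm_range'.1 h⟩

theorem Layered.perm {l : List ℕ} (h : Layered l) : l.Perm (List.range' 1 l.length) := by
  induction h with
  | nil => exact .nil
  | one _ ih => exact cons_length_perm_range'.2 ih
  | @two l _ ih =>
    exact (List.Perm.swap _ _ _).trans <|
      cons_length_perm_range' (l := (l.length + 1) :: l).2 (cons_length_perm_range'.2 ih)

theorem Layered.le_length {l : List ℕ} (h : Layered l) {x : ℕ} (hx : x ∈ l) : x ≤ l.length := by
  have := h.perm.mem_iff.1 hx
  rw [List.mem_range'_1] at this
  omega

/-- Every letter is larger than all later letters except possibly the next one. -/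
def SkipDecreasing (l : List ℕ) : Prop := l.Triplewise fun x _ z => z < x

theorem skipDecreasing_cons {a : ℕ} {l : List ℕ} :
    SkipDecreasing (a :: l) ↔ (∀ x ∈ l.tail, x < a) ∧ SkipDecreasing l := by
  refine List.triplewise_cons.trans (and_congr_left fun _ => ?_)
  cases l with
  | nil => simp
  | cons b l =>
    exact List.pairwise_cons.trans <| and_iff_left_of_imp fun h =>
      List.pairwise_of_forall_mem_list fun _ _ z hz => h z hz

theorem Layered.skipDecreasing {l : List ℕ} (h : Layered l) : SkipDecreasing l := by
  induction h with
  | nil => exact .nil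
  | one h ih =>
    exact skipDecreasing_cons.2
      ⟨fun x hx => Nat.lt_succ_of_le (h.le_length (List.mem_of_mem_tail hx)), ih⟩
  | two h ih =>
    exact skipDecreasing_cons.2 ⟨fun x hx => Nat.lt_succ_of_le (h.le_length hx),
      skipDecreasing_cons.2
        ⟨fun x hx => (h.le_length (List.mem_of_mem_tail hx)).trans_lt (by omega), ih⟩⟩

theorem SkipDecreasing.layered {l : List ℕ} (h : SkipDecreasing l)
    (hl : l.Perm (List.range' 1 l.length)) : Layered l := by
  induction hn : l.length using Nat.strong_induction_on generalizing l with
  | _ n ih =>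
  rcases l with _ | ⟨a, l⟩
  · exact .nil
  obtain ⟨hla, htail⟩ := skipDecreasing_cons.1 h
  by_cases hmax : ∀ x ∈ l, x < a
  · obtain ⟨rfl, hl'⟩ := perm_range'_of_cons_of_forall_lt hl hmax
    exact .one (ih _ (by simp at hn; omega) htail hl' rfl)
  · rcases l with _ | ⟨b, l⟩
    · simp at hmax
    rw [List.tail_cons] at hla
    have hab : a < b := by
      have hne : a ≠ b := fun hab => by
        simpa [hab] using hl.nodup_iff.2 List.nodup_range'
      simp only [List.forall_mem_cons, not_and] at hmax
      exact lt_of_le_of_ne (not_lt.1 fun hba => hmax hba hla) hne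
    obtain ⟨hb, hl'⟩ := perm_range'_of_cons_of_forall_lt ((List.Perm.swap _ _ _).trans hl)
      (List.forall_mem_cons.2 ⟨hab, fun x hx => (hla x hx).trans hab⟩)
    obtain ⟨rfl, hl''⟩ := perm_range'_of_cons_of_forall_lt hl' hla
    rw [hb]
    exact .two (ih _ (by simp at hn; omega) (skipDecreasing_cons.1 htail).2 hl'' rfl)

theorem avoids_triple_iff {w : List ℕ} {a b c : ℕ} :
    Avoids w [a, b, c] ↔ w.Triplewise fun x y z => ¬ (((x ≤ y ↔ a ≤ b) ∧ (y ≤ x ↔ b ≤ a)) ∧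
      ((x ≤ z ↔ a ≤ c) ∧ (z ≤ x ↔ c ≤ a)) ∧ ((y ≤ z ↔ b ≤ c) ∧ (z ≤ y ↔ c ≤ b))) := by
  rw [List.triplewise_iff_getElem]
  constructor
  · rintro h i j k hij hjk hk ⟨⟨hxy, hyx⟩, ⟨hxz, hzx⟩, hyz, hzy⟩
    refine h ⟨![⟨i, by omega⟩, ⟨j, by omega⟩, ⟨k, hk⟩], fun p q hpq => ?_, fun p q => ?_⟩
    · fin_cases p <;> fin_cases q <;> simp_all
      omega
    · fin_cases p <;> fin_cases q <;> simp_all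
  · rintro h ⟨f, hf, hw⟩
    have hf₀₁ : f (0 : Fin 3) < f (1 : Fin 3) := hf (show (0 : Fin 3) < 1 by decide)
    have hf₁₂ : f (1 : Fin 3) < f (2 : Fin 3) := hf (show (1 : Fin 3) < 2 by decide)
    exact h _ _ _ hf₀₁ hf₁₂ (f (2 : Fin 3)).2
      ⟨⟨hw (0 : Fin 3) (1 : Fin 3), hw (1 : Fin 3) (0 : Fin 3)⟩,
        ⟨hw (0 : Fin 3) (2 : Fin 3), hw (2 : Fin 3) (0 : Fin 3)⟩,
        hw (1 : Fin 3) (2 : Fin 3), hw (2 : Fin 3) (1 : Fin 3)⟩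

/-- The three patterns are the relative orders of distinct `x, y, z` with `x < z`. -/
theorem avoids_iff_skipDecreasing {l : List ℕ} (hl : l.Nodup) :
    (∀ ρ ∈ [[1, 2, 3], [1, 3, 2], [2, 1, 3]], Avoids l ρ) ↔ SkipDecreasing l := by
  simp only [List.forall_mem_cons, List.not_mem_nil, IsEmpty.forall_iff, implies_true, and_true,
    avoids_triple_iff, SkipDecreasing, List.triplewise_iff_getElem]
  constructor
  · rintro ⟨h₁₂₃, h₁₃₂, h₂₁₃⟩ i j k hij hjk hk
    have hxy : l[i] ≠ l[j] := fun h => hij.ne (hl.getElem_inj_iff.1 h)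
    have hxz : l[i] ≠ l[k] := fun h => (hij.trans hjk).ne (hl.getElem_inj_iff.1 h)
    have hyz : l[j] ≠ l[k] := fun h => hjk.ne (hl.getElem_inj_iff.1 h)
    specialize h₁₂₃ i j k hij hjk hk
    specialize h₁₃₂ i j k hij hjk hk
    specialize h₂₁₃ i j k hij hjk hk
    omega
  · intro h
    refine ⟨fun i j k hij hjk hk => ?_, fun i j k hij hjk hk => ?_, fun i j k hij hjk hk => ?_⟩ <;>
      have := h i j k hij hjk hk <;> omega

theorem layered_iff {l : List ℕ} :
    Layered l ↔ l.Perm (List.range' 1 l.length) ∧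
      ∀ ρ ∈ [[1, 2, 3], [1, 3, 2], [2, 1, 3]], Avoids l ρ := by
  have avoids (h : l.Perm (List.range' 1 l.length)) :=
    avoids_iff_skipDecreasing (h.nodup_iff.2 List.nodup_range')
  exact ⟨fun h => ⟨h.perm, (avoids h.perm).2 h.skipDecreasing⟩,
    fun h => ((avoids h.1).1 h.2).layered h.1⟩

/-! ### Parking functions as Motzkin paths -/

/-- The height gained by a step of a lattice path, measured from the diagonal. -/
def Step.rise : Step → ℤ
  | north _ => 1
  | east => -1

/-- Can the second step come right after the first one in a parking function? Only for two north
steps is there a condition on the labels. -/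
def Step.Increases : Step → Step → Prop
  | north a, north b => a < b
  | _, _ => True

theorem labels_north (a : ℕ) (p : List Step) : labels (.north a :: p) = a :: labels p := rfl

theorem labels_east (p : List Step) : labels (.east :: p) = labels p := rfl

theorem numNorth_north (a : ℕ) (p : List Step) : numNorth (.north a :: p) = numNorth p + 1 :=
  List.countP_cons_of_pos rfl

theorem numNorth_east (p : List Step) : numNorth (.east :: p) = numNorth p :=
  List.countP_cons_of_neg (by simp [Step.isEast])

theorem length_labels (p : List Step) : (labels p).length = numNorth p := by
  induction p with
  | nil => rfl
  | cons s p ih =>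
    cases s with
    | north a => rw [labels_north, numNorth_north, List.length_cons, ih]
    | east => rw [labels_east, numNorth_east, ih]

theorem sum_rise (p : List Step) : (p.map Step.rise).sum = numNorth p - numEast p := by
  induction p with
  | nil => rfl
  | cons s p ih =>
    cases s <;> simp [ih, Step.rise, numNorth, numEast, Step.isEast, List.countP_cons] <;> omega

theorem isParkingFunction_and_avoids_iff {n : ℕ} {p : List Step} :
    (IsParkingFunction n p ∧ ∀ ρ ∈ [[1, 2, 3], [1, 3, 2], [2, 1, 3]], Avoids (labels p) ρ) ↔
      numNorth p = n ∧ IsExcursion Step.rise p ∧ Layered (labels p) ∧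
        p.IsChain Step.Increases := by
  have hexc : IsExcursion Step.rise p ↔
      (∀ q, q <+: p → numEast q ≤ numNorth q) ∧ numEast p = numNorth p := by
    simp only [IsExcursion, StaysNonneg, sum_rise]
    exact and_congr (forall₂_congr fun q _ => by omega) (by omega)
  have hchain : p.IsChain Step.Increases ↔
      ∀ (q r : List Step) (a b : ℕ), p = q ++ .north a :: .north b :: r → a < b := by
    rw [List.isChain_iff_forall_rel_of_append_cons_cons]
    refine ⟨fun h q r a b => @h _ _ q r, fun h s t q r => ?_⟩
    cases s <;> cases t <;> simp only [Step.Increases, implies_true]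
    exact h q r _ _
  rw [hexc, hchain, layered_iff, length_labels]
  constructor
  · rintro ⟨⟨rfl, heast, hle, hperm, hinc⟩, havoids⟩
    exact ⟨rfl, ⟨hle, heast⟩, ⟨hperm, havoids⟩, hinc⟩
  · rintro ⟨rfl, ⟨hle, heast⟩, ⟨hperm, havoids⟩, hinc⟩
    exact ⟨⟨rfl, heast, hle, hperm, hinc⟩, havoids⟩

/-- The labeled path of a Motzkin path. In phase `ready` a block of labels starts: an up step is
the first north step of a block of length two, and a flat step is a block of length one. In phase
`pending` a flat step completes a block of length two. The north step that ends a block is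
followed by an east step, which has no step of its own in the Motzkin path. -/
def toPath : Phase → List MotzkinStep → List Step
  | _, [] => []
  | s, .down :: w => .east :: toPath s w
  | _, .up :: w => .north (numCars w) :: toPath pending w
  | ready, .flat :: w => .north (numCars w + 1) :: .east :: toPath ready w
  | pending, .flat :: w => .north (numCars w + 2) :: .east :: toPath ready w

theorem numNorth_toPath (s : Phase) (w : List MotzkinStep) :
    numNorth (toPath s w) = numCars w := by
  induction w generalizing s with
  | nil => rfl
  | cons x w ih =>
    cases s <;> cases x <;> simp [toPath, numNorth_north, numNorth_east, ih, numCars_cons, isCar]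

theorem length_labels_toPath (s : Phase) (w : List MotzkinStep) :
    (labels (toPath s w)).length = numCars w := by
  rw [length_labels, numNorth_toPath]

theorem length_add_one_eq_numCars {s : Phase} {w : List MotzkinStep} {a : ℕ} {t : List ℕ}
    (h : labels (toPath s w) = a :: t) : t.length + 1 = numCars w := by
  rw [← length_labels_toPath s, h, List.length_cons]

theorem toPath_injective (s : Phase) : Function.Injective (toPath s) := by
  have ne_up_flat {u v : List MotzkinStep} {s : Phase} :
      toPath s (up :: u) ≠ toPath s (flat :: v) := by
    intro h
    have hcars : numCars u = numCars v := by
      simpa [numNorth_toPath, numCars_cons, isCar] using congrArg numNorth h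
    cases s <;> simp [toPath, hcars] at h
  intro u v h
  induction u generalizing s v with
  | nil =>
    rcases v with _ | ⟨y, v⟩
    · rfl
    · cases s <;> cases y <;> simp [toPath] at h
  | cons x u ih =>
    rcases v with _ | ⟨y, v⟩
    · cases s <;> cases x <;> simp [toPath] at h
    · cases x <;> cases y
      case up.flat => exact (ne_up_flat h).elim
      case flat.up => exact (ne_up_flat h.symm).elim
      case flat.flat =>
        cases s <;> simp only [toPath, List.cons.injEq, true_and] at h <;> rw [ih _ h.2]
      case up.up => simp only [toPath, List.cons.injEq] at h; rw [ih _ h.2]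
      case down.down => simp only [toPath, List.cons.injEq, true_and] at h; rw [ih _ h]
      all_goals cases s <;> simp [toPath] at h

theorem staysNonneg_toPath {s : Phase} {h : ℤ} {w : List MotzkinStep} :
    StaysNonneg Step.rise h (toPath s w) ↔ StaysNonneg rise h w := by
  induction w generalizing s h with
  | nil => simp [toPath, staysNonneg_nil]
  | cons x w ih =>
    cases s <;> cases x <;> simp [toPath, staysNonneg_cons, ih, Step.rise, rise] <;> omega

theorem sum_rise_toPath (s : Phase) (w : List MotzkinStep) :
    ((toPath s w).map Step.rise).sum = (w.map rise).sum := by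
  induction w generalizing s with
  | nil => rfl
  | cons x w ih => cases s <;> cases x <;> simp [toPath, ih, Step.rise, rise]

theorem isExcursion_toPath {s : Phase} {w : List MotzkinStep} :
    IsExcursion Step.rise (toPath s w) ↔ IsExcursion rise w := by
  rw [IsExcursion, IsExcursion, staysNonneg_toPath, sum_rise_toPath]

/-- The words of labels that can be read from a given phase on: in phase `pending`, the first
letter completes a block of length two. -/
def Follows : Phase → List ℕ → Prop
  | ready, l => Layered l
  | pending, l => ∃ t, Layered t ∧ l = (t.length + 2) :: t

theorem follows_labels_toPath {s : Phase} {w : List MotzkinStep} (hr : s.run w = some ready) :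
    Follows s (labels (toPath s w)) := by
  induction hr using run_eq_ready_induction with
  | nil => exact .nil
  | up w _ ih =>
    obtain ⟨t, ht, hw⟩ := ih
    have hlen := length_add_one_eq_numCars hw
    rw [toPath, labels_north, hw, ← hlen]
    exact .two ht
  | flat s w _ ih =>
    cases s with
    | ready =>
      rw [toPath, labels_north, labels_east, ← length_labels_toPath ready w]
      exact .one ih
    | pending =>
      rw [toPath, labels_north, labels_east, ← length_labels_toPath ready w]
      exact ⟨_, ih, rfl⟩
  | down _ _ _ ih => exact ih

theorem isChain_toPath {s : Phase} {w : List MotzkinStep} (hr : s.run w = some ready) :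
    (toPath s w).IsChain Step.Increases := by
  induction hr using run_eq_ready_induction with
  | nil => exact .nil
  | up w hr ih =>
    refine List.isChain_cons.2 ⟨fun x hx => ?_, ih⟩
    obtain ⟨t, -, hw⟩ := follows_labels_toPath hr
    have hlen := length_add_one_eq_numCars hw
    cases x with
    | north b =>
      obtain ⟨p, hp⟩ : ∃ p, toPath pending w = .north b :: p := by
        simpa [List.head?_eq_some_iff] using hx
      rw [hp, labels_north] at hw
      obtain ⟨rfl, -⟩ := List.cons.inj hw
      change numCars w < t.length + 2
      omega
    | east => trivial
  | flat s w _ ih =>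
    have hend : (.east :: toPath ready w).IsChain Step.Increases :=
      List.isChain_cons.2 ⟨by simp [Step.Increases], ih⟩
    cases s <;> exact List.isChain_cons_cons.2 ⟨trivial, hend⟩
  | down s w _ ih => exact List.isChain_cons.2 ⟨by simp [Step.Increases], ih⟩

theorem eq_east_cons_of_forall_labels_lt {a : ℕ} {p : List Step}
    (hchain : (.north a :: p).IsChain Step.Increases) (hend : p ≠ [])
    (hlt : ∀ b ∈ labels p, b < a) : ∃ q, p = .east :: q := by
  rcases p with _ | ⟨_ | _, p⟩
  · exact (hend rfl).elim
  · rename_i b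
    exact ((hlt b (by simp [labels_north])).not_gt (List.isChain_cons_cons.1 hchain).1).elim
  · exact ⟨p, rfl⟩

theorem exists_toPath_eq {s : Phase} {p : List Step} (hf : Follows s (labels p))
    (hchain : p.IsChain Step.Increases) (hend : ∀ q a, p ≠ q ++ [.north a]) :
    ∃ w, s.run w = some ready ∧ toPath s w = p := by
  induction hn : p.length using Nat.strong_induction_on generalizing s p with
  | _ n ih =>
  rcases p with _ | ⟨x, p⟩
  · cases s with
    | ready => exact ⟨[], rfl, rfl⟩
    | pending => obtain ⟨t, -, h⟩ := hf; cases h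
  rw [List.length_cons] at hn
  have hend' (q : List Step) (b : ℕ) : p ≠ q ++ [.north b] :=
    fun h => hend (x :: q) b (by rw [h, List.cons_append])
  cases x with
  | east =>
    obtain ⟨w, hr, rfl⟩ := ih _ (by omega) (s := s) (p := p) hf hchain.tail hend' rfl
    exact ⟨down :: w, hr, rfl⟩
  | north a =>
    have exists_block_end (hp : Layered (labels p)) (ha : (labels p).length < a) :
        ∃ w, ready.run w = some ready ∧ p = .east :: toPath ready w := by
      obtain ⟨q, rfl⟩ := eq_east_cons_of_forall_labels_lt hchain (by simpa using hend [] a)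
        fun b hb => (hp.le_length hb).trans_lt ha
      obtain ⟨w, hr, rfl⟩ := ih _ (by simp at hn; omega) (s := ready) (p := q) hp hchain.tail.tail
        (fun r b h => hend' (.east :: r) b (by rw [h, List.cons_append])) rfl
      exact ⟨w, hr, rfl⟩
    rw [labels_north] at hf
    cases s with
    | ready =>
      generalize hl : labels p = l at hf
      cases hf with
      | one hp =>
        subst hl
        obtain ⟨w, hr, rfl⟩ := exists_block_end hp (by omega)
        exact ⟨flat :: w, hr, by rw [toPath, labels_east, length_labels_toPath]⟩
      | @two t ht =>
        obtain ⟨w, hr, rfl⟩ := ih _ (by omega) (s := pending) ⟨t, ht, hl⟩ hchain.tail hend' rfl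
        exact ⟨up :: w, hr, by rw [toPath, length_add_one_eq_numCars hl]⟩
    | pending =>
      obtain ⟨t, ht, hl⟩ := hf
      obtain ⟨rfl, rfl⟩ := List.cons.inj hl
      obtain ⟨w, hr, rfl⟩ := exists_block_end ht (by omega)
      exact ⟨flat :: w, hr, by rw [toPath, labels_east, length_labels_toPath]⟩

theorem IsExcursion.ne_concat_north {p : List Step} (hp : IsExcursion Step.rise p) (q : List Step)
    (a : ℕ) : p ≠ q ++ [.north a] := by
  rintro rfl
  have hq := hp.1 q (List.prefix_append _ _)
  have hsum := hp.2
  simp [Step.rise] at hsum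
  omega

theorem pf_eq_ncard_leafyForest (n : ℕ) :
    pf n [[1, 2, 3], [1, 3, 2], [2, 1, 3]] =
      Set.ncard {c : LeafyForest ready | numCars c.toMotzkin = n} := by
  have hinj : Function.Injective fun c : LeafyForest ready => toPath ready c.toMotzkin :=
    (toPath_injective ready).comp LeafyForest.toMotzkin_injective
  rw [← Set.ncard_image_of_injective _ hinj, pf]
  congr 1
  ext p
  rw [Set.mem_ofPred_eq, isParkingFunction_and_avoids_iff]
  constructor
  · rintro ⟨hn, hexc, hlayered, hchain⟩
    obtain ⟨w, hr, rfl⟩ := exists_toPath_eq (s := ready) hlayered hchain hexc.ne_concat_north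
    obtain ⟨c, rfl⟩ := LeafyForest.exists_toMotzkin_eq (isExcursion_toPath.1 hexc) hr
    exact ⟨c, by rwa [numNorth_toPath] at hn, rfl⟩
  · rintro ⟨c, rfl, rfl⟩
    exact ⟨numNorth_toPath _ _, isExcursion_toPath.2 c.isExcursion_toMotzkin,
      follows_labels_toPath c.run_toMotzkin, isChain_toPath c.run_toMotzkin⟩

end PatternParking

theorem theoremT (n : ℕ) :
    PatternParking.pf n [[1, 2, 3], [1, 3, 2], [2, 1, 3]] =
      Set.ncard {t : PatternParking.OrderedTree | t.numEdges = n + 1 ∧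
        ∀ v : List ℕ, t.IsVertex v → t.IsLeaf v ∨ ∃ u : List ℕ, t.Adj v u ∧ t.IsLeaf u} :=
  (PatternParking.pf_eq_ncard_leafyForest n).trans
    (PatternParking.ncard_leafDominated_trees n).symm
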